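/- Let $G$ be a cotorsion abelian group, that is, an abelian group such that $\mathrm{Ext}(J,G)=0$ for every torsion-free abelian group $J$ (equivalently, every short exact sequence of abelian groups $0\to G\to E\to J\to 0$ with $J$ torsion-free splits). Then the following hold. (1) $G$ is co-finitely surjective (every endomorphism $\varphi\colon G\to G$ with $G/\varphi(G)$ finite is surjective) if and only if $G$ is divisible (that is, $nG=G$ for every nonzero integer $n$). (2) $G$ is co-finitely Hopfian (every endomorphism $\varphi\colon G\to G$ with $G/\varphi(G)$ finite is an automorphism) if and only if $G$ is torsion-free, divisible, and of finite rank, where the rank of a torsion-free abelian group is the maximal cardinality of a $\mathbb{Z}$-linearly independent subset. -/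

import Mathlib

universe u

/-- An abelian group `G` is cotorsion if `Ext(J, G) = 0` for every torsion-free abelian group `J`,
i.e. every extension `0 → G → E → J → 0` of `G` by a torsion-free abelian group `J` splits:
the embedding of `G` into `E` has a retraction. -/
def IsCotorsion (G : Type u) [AddCommGroup G] : Prop :=
  ∀ (E J : Type u) [AddCommGroup E] [AddCommGroup J] [IsAddTorsionFree J]
    (f : G →+ E) (g : E →+ J),
    Function.Injective f → Function.Surjective g → Function.Exact f g →
      ∃ r : E →+ G, r.comp f = AddMonoidHom.id G

/-- Every endomorphism with finite cokernel is surjective. -/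
def IsCoFinitelySurjective (G : Type u) [AddCommGroup G] : Prop :=
  ∀ φ : G →+ G, Finite (G ⧸ φ.range) → Function.Surjective φ

/-- Every endomorphism with finite cokernel is an automorphism. -/
def IsCoFinitelyHopfian (G : Type u) [AddCommGroup G] : Prop :=
  ∀ φ : G →+ G, Finite (G ⧸ φ.range) → Function.Bijective φ

/-- `G` is divisible: `n G = G` for every nonzero integer `n`. -/
def IsDivisibleGroup (G : Type u) [AddCommGroup G] : Prop :=
  Nonempty (DivisibleBy G ℤ)

/-! A finite cokernel of order c forces cG into the range, so divisible groups are co-finitely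
surjective. Conversely, let x lie outside pG; a nonzero p-primary cyclic or p-adic summand then
spoils surjectivity. If some element of order p has finite p-height, G has a summand Z/p^(k+1), and
projecting it away leaves a finite cokernel. Otherwise maps G → Z/p lift to `ℤ_[p]`, while cotorsion
gives a map `ℤ_[p]` → G hitting x modulo p; the composite on `ℤ_[p]` is a unit, so `ℤ_[p]` is a
summand, and multiplying it by p has cokernel Z/p. For the Hopfian part, G is divisible, so
multiplication by n is onto, hence injective. What remains is linear algebra over ℚ. -/

theorem isAddTorsionFree_quotient {E : Type*} [AddCommGroup E] (S : AddSubgroup E)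
    (h : ∀ (n : ℕ) (e : E), n ≠ 0 → n • e ∈ S → e ∈ S) : IsAddTorsionFree (E ⧸ S) := by
  refine ⟨fun n hn u v huv ↦ ?_⟩
  obtain ⟨a, rfl⟩ := QuotientAddGroup.mk_surjective u
  obtain ⟨b, rfl⟩ := QuotientAddGroup.mk_surjective v
  have hab : -(n • a) + n • b ∈ S := QuotientAddGroup.eq.1 huv
  refine QuotientAddGroup.eq.2 (h n _ hn ?_)
  rwa [smul_add, smul_neg]

/-! ### Maps from the p-adic integers into a cotorsion group -/

/-- A subgroup generated by an element `c` of infinite order with torsion-free quotient: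
homomorphisms from it into a cotorsion group extend. -/
theorem IsCotorsion.exists_hom_apply_eq {G : Type u} [AddCommGroup G] (hG : IsCotorsion G)
    {F : Type} [AddCommGroup F] (c : F) (hc : ∀ k : ℤ, k • c = 0 → k = 0)
    (hF : ∀ (n : ℕ) (a : F) (m : ℤ), n ≠ 0 → n • a = m • c → ∃ k : ℤ, a = k • c) (x : G) :
    ∃ f : F →+ G, f c = x := by
  -- The quotient by K is the pushout of F along c ↦ x; a retraction onto G restricts to the wanted
  -- map on F.
  let K : AddSubgroup (G × F) := AddSubgroup.zmultiples (x, -c)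
  let f : G →+ (G × F) ⧸ K := (QuotientAddGroup.mk' K).comp (AddMonoidHom.inl G F)
  have hf : Function.Injective f := by
    rw [injective_iff_map_eq_zero]
    intro y hy
    have hy' : ((y, 0) : G × F) ∈ K := (QuotientAddGroup.eq_zero_iff _).1 hy
    obtain ⟨k, hk⟩ := AddSubgroup.mem_zmultiples_iff.1 hy'
    have h1 : k • x = y := congrArg Prod.fst hk
    have h2 : k • (-c) = 0 := congrArg Prod.snd hk
    rw [smul_neg, neg_eq_zero] at h2
    rw [← h1, hc k h2, zero_smul]
  have hrange : ∀ (y : G) (a : F),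
      (QuotientAddGroup.mk' K (y, a)) ∈ f.range ↔ ∃ k : ℤ, a = k • c := by
    intro y a
    constructor
    · rintro ⟨z, hz⟩
      have hz' : -((z, 0) : G × F) + (y, a) ∈ K := QuotientAddGroup.eq.1 hz
      obtain ⟨k, hk⟩ := AddSubgroup.mem_zmultiples_iff.1 hz'
      have h2 : k • (-c) = -0 + a := congrArg Prod.snd hk
      refine ⟨-k, ?_⟩
      rw [neg_zero, zero_add] at h2
      rw [← h2, smul_neg, neg_smul]
    · rintro ⟨k, rfl⟩
      refine ⟨y + k • x, QuotientAddGroup.eq.2 ?_⟩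
      refine AddSubgroup.mem_zmultiples_iff.2 ⟨-k, ?_⟩
      ext <;> simp
  have : IsAddTorsionFree (((G × F) ⧸ K) ⧸ f.range) :=
    isAddTorsionFree_quotient _ fun n e hn h ↦ by
      obtain ⟨⟨y, a⟩, rfl⟩ := QuotientAddGroup.mk_surjective e
      obtain ⟨m, hm⟩ := (hrange (n • y) (n • a)).1 h
      exact (hrange y a).2 (hF n a m hn hm)
  let g : (G × F) ⧸ K →+ ((G × F) ⧸ K) ⧸ f.range := QuotientAddGroup.mk' f.range
  have hexact : Function.Exact f g := fun e ↦ QuotientAddGroup.eq_zero_iff e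
  obtain ⟨r, hr⟩ := hG ((G × F) ⧸ K) (((G × F) ⧸ K) ⧸ f.range) f g hf
    (QuotientAddGroup.mk'_surjective _) hexact
  refine ⟨r.comp ((QuotientAddGroup.mk' K).comp (AddMonoidHom.inr G F)), ?_⟩
  have hx : QuotientAddGroup.mk' K (0, c) = f x := by
    refine QuotientAddGroup.eq.2 (AddSubgroup.mem_zmultiples_iff.2 ⟨1, ?_⟩)
    ext <;> simp
  calc r (QuotientAddGroup.mk' K (0, c)) = r (f x) := by rw [hx]
    _ = x := DFunLike.congr_fun hr x

/-- Every element of a cotorsion group is, modulo `p`, the image of `1` under a homomorphism from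
the `p`-adic integers. -/
theorem IsCotorsion.exists_padicInt_hom {G : Type u} [AddCommGroup G] (hG : IsCotorsion G)
    (p : ℕ) [hp : Fact p.Prime] (x : G) :
    ∃ (f : ℤ_[p] →+ G) (w : G), x = f 1 + p • w := by
  let L : AddSubgroup ℚ :=
    { carrier := {b | ∃ (t : ℕ) (c : ℤ), (p : ℚ) ^ t * b = c}
      zero_mem' := ⟨0, 0, by simp⟩
      add_mem' := by
        rintro a b ⟨s, c, h⟩ ⟨t, d, h'⟩
        refine ⟨s + t, p ^ t * c + p ^ s * d, ?_⟩
        push_cast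
        rw [← h, ← h']; ring
      neg_mem' := by
        rintro a ⟨s, c, h⟩
        exact ⟨s, -c, by push_cast; rw [← h]; ring⟩ }
  have hp0 : (p : ℚ) ≠ 0 := Nat.cast_ne_zero.2 hp.out.ne_zero
  let one : L := ⟨1, 0, 1, by simp⟩
  let inv : L := ⟨(p : ℚ)⁻¹, 1, 1, by simp [hp0]⟩
  -- In `ℤ_[p]` alone, 1 is divisible by every prime other than p. The factor L = ℤ[1/p] rules these
  -- out and `ℤ_[p]` rules out p, so (1, 1) generates a pure subgroup. As 1 is p-divisible in L, the
  -- second factor contributes only an element of pG.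
  obtain ⟨f, hf⟩ := hG.exists_hom_apply_eq (F := ℤ_[p] × L) (1, one)
    (fun k hk ↦ by
      have h : k • (1 : ℤ_[p]) = 0 := congrArg Prod.fst hk
      simpa using h)
    (by
      rintro n ⟨a, b, t, c, hb⟩ m hn h
      have h1 : n • a = m • (1 : ℤ_[p]) := congrArg Prod.fst h
      have h2 : n • b = m • (1 : ℚ) := congrArg (fun y ↦ (y.2 : ℚ)) h
      rw [nsmul_eq_mul, zsmul_eq_mul, mul_one] at h1 h2
      obtain ⟨s, n', hn', rfl⟩ := Nat.exists_eq_pow_mul_and_not_dvd hn p hp.out.ne_one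
      have hcop : IsCoprime (n' : ℤ) (p : ℤ) :=
        Nat.isCoprime_iff_coprime.2 ((Nat.Prime.coprime_iff_not_dvd hp.out).2 hn').symm
      have d1 : ((p : ℤ) ^ s) ∣ m := by
        rw [← PadicInt.pow_p_dvd_int_iff, ← h1]
        exact ⟨n' * a, by push_cast; ring⟩
      have d2 : (n' : ℤ) ∣ m := by
        have h3 : (n' : ℤ) * (p ^ s * c) = m * p ^ t := by
          have : ((n' : ℚ)) * (p ^ s * c) = m * p ^ t := by
            rw [← hb, ← h2]; push_cast; ring
          exact_mod_cast this
        exact (hcop.pow_right (n := t)).dvd_of_dvd_mul_right ⟨_, h3.symm⟩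
      obtain ⟨k, rfl⟩ := (hcop.pow_right (n := s)).symm.mul_dvd d1 d2
      refine ⟨k, Prod.ext ?_ (Subtype.ext ?_)⟩
      · have hn0 : ((p ^ s * n' : ℕ) : ℤ_[p]) ≠ 0 := Nat.cast_ne_zero.2 hn
        refine mul_left_cancel₀ hn0 (h1.trans ?_)
        simp
      · have hn0 : ((p ^ s * n' : ℕ) : ℚ) ≠ 0 := Nat.cast_ne_zero.2 hn
        refine mul_left_cancel₀ hn0 (h2.trans ?_)
        simp [one]) x
  refine ⟨f.comp (AddMonoidHom.inl _ _), f (0, inv), ?_⟩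
  have h1 : p • inv = one := Subtype.ext (by simp [inv, one, hp0])
  rw [← map_nsmul, AddMonoidHom.comp_apply, ← map_add, ← hf]
  congr 1
  ext1 <;> simp [h1]

/-! ### Characters and lifting to the p-adic integers -/

/-- A circle-valued homomorphism extends along a homomorphism whose kernel it kills. -/
theorem exists_addCircle_hom_comp_eq {A B : Type*} [AddCommGroup A] [AddCommGroup B]
    (α : A →+ B) (μ : A →+ UnitAddCircle) (h : α.ker ≤ μ.ker) :
    ∃ ν : B →+ UnitAddCircle, ∀ a, ν (α a) = μ a := by
  obtain ⟨ν, hν⟩ := (Module.Baer.of_divisible UnitAddCircle).extension_property_addMonoidHom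
    (QuotientAddGroup.kerLift α) (QuotientAddGroup.kerLift_injective α)
    (QuotientAddGroup.lift α.ker μ h)
  exact ⟨ν, fun a ↦ DFunLike.congr_fun hν (a : A ⧸ α.ker)⟩

/-- Circle-valued homomorphisms killed by `N` factor through `ZMod N`. -/
theorem exists_zmod_hom_toAddCircle_eq {A : Type*} [AddCommGroup A] (N : ℕ) [NeZero N]
    (χ : A →+ UnitAddCircle) (h : ∀ a, N • χ a = 0) :
    ∃ ψ : A →+ ZMod N, ∀ a, ZMod.toAddCircle (ψ a) = χ a := by
  have hr : ∀ a, ∃ c : ZMod N, ZMod.toAddCircle c = χ a := by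
    intro a
    obtain ⟨m, -, hm⟩ := (AddCircle.nsmul_eq_zero_iff (NeZero.pos N)).1 (h a)
    refine ⟨(m : ZMod N), ?_⟩
    rw [ZMod.toAddCircle_natCast, ← hm, mul_one]
  choose ψ hψ using hr
  refine ⟨AddMonoidHom.mk' ψ fun a b ↦ ZMod.toAddCircle_injective N ?_, hψ⟩
  rw [map_add, hψ, hψ, hψ, map_add]

/-- An element whose multiple by `p ^ k` does not lie in `p ^ (k + 1) G` is sent to `1` by some
homomorphism to `ZMod (p ^ (k + 1))`. -/
theorem exists_zmod_hom_apply_eq_one {G : Type*} [AddCommGroup G] (p : ℕ) [hp : Fact p.Prime]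
    (k : ℕ) (y : G) (hy : ∀ w : G, p ^ k • y ≠ p ^ (k + 1) • w) :
    ∃ ψ : G →+ ZMod (p ^ (k + 1)), ψ y = 1 := by
  let N := p ^ (k + 1)
  have : NeZero N := ⟨pow_ne_zero _ hp.out.ne_zero⟩
  let P : AddSubgroup G := (nsmulAddMonoidHom N : G →+ G).range
  have hP : ∀ g : G ⧸ P, N • g = 0 := by
    intro g
    obtain ⟨z, rfl⟩ := QuotientAddGroup.mk_surjective g
    exact (QuotientAddGroup.eq_zero_iff _).2 ⟨z, rfl⟩
  have hord : addOrderOf (y : G ⧸ P) = N := by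
    refine addOrderOf_eq_prime_pow (fun h0 ↦ ?_) (hP _)
    obtain ⟨w, hw⟩ := (QuotientAddGroup.eq_zero_iff (p ^ k • y)).1 h0
    exact hy w hw.symm
  let α : ZMod N →+ G ⧸ P :=
    ZMod.lift N ⟨zmultiplesHom _ (y : G ⧸ P), by simpa using hP _⟩
  have hα : ∀ j : ℤ, α j = j • (y : G ⧸ P) := fun j ↦ by simp [α]
  obtain ⟨ν, hν⟩ := exists_addCircle_hom_comp_eq α ZMod.toAddCircle (fun c hc ↦ by
    obtain ⟨j, rfl⟩ := ZMod.intCast_surjective c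
    rw [AddMonoidHom.mem_ker, hα, ← addOrderOf_dvd_iff_zsmul_eq_zero, hord] at hc
    rw [AddMonoidHom.mem_ker, (ZMod.intCast_zmod_eq_zero_iff_dvd j N).2 hc, map_zero])
  obtain ⟨ψ, hψ⟩ := exists_zmod_hom_toAddCircle_eq N ν
    (fun a ↦ by rw [← map_nsmul, hP, map_zero])
  refine ⟨ψ.comp (QuotientAddGroup.mk' P), ZMod.toAddCircle_injective N ?_⟩
  have h1 := hα 1
  rw [one_smul, Int.cast_one] at h1
  rw [← hν 1, h1]
  exact hψ _

/-- If all elements of order `p` are divisible by all powers of `p`, then homomorphisms to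
`ZMod p` lift to the `p`-adic integers. -/
theorem exists_padicInt_hom_lift {G : Type*} [AddCommGroup G] (p : ℕ) [hp : Fact p.Prime]
    (hG : ∀ z : G, p • z = 0 → ∀ n : ℕ, ∃ w : G, z = p ^ n • w) (ψ₁ : G →+ ZMod p) :
    ∃ g : G →+ ℤ_[p], ∀ y, PadicInt.toZMod (g y) = ψ₁ y := by
  have hne : ∀ n, NeZero (p ^ n) := fun n ↦ ⟨pow_ne_zero _ hp.out.ne_zero⟩
  have : NeZero p := ⟨hp.out.ne_zero⟩
  have step : ∀ (n : ℕ) (χ : G →+ UnitAddCircle), (∀ y, p ^ n • χ y = 0) →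
      ∃ χ' : G →+ UnitAddCircle, (∀ y, p ^ (n + 1) • χ' y = 0) ∧ ∀ y, p • χ' y = χ y := by
    intro n χ hχ
    let P : AddSubgroup G := (nsmulAddMonoidHom (p ^ (n + 1)) : G →+ G).range
    obtain ⟨ν, hν⟩ := exists_addCircle_hom_comp_eq
      ((QuotientAddGroup.mk' P).comp (nsmulAddMonoidHom p)) χ (fun y hy ↦ by
        obtain ⟨w, hw⟩ := (QuotientAddGroup.eq_zero_iff (p • y)).1 hy
        have hw' : p ^ (n + 1) • w = p • y := hw
        -- The difference has order dividing p, so it lies in p^n G; hence so does y, and χ kills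
        -- it.
        obtain ⟨v, hv⟩ := hG (y - p ^ n • w) (by
          rw [smul_sub, smul_smul, ← pow_succ', hw', sub_self]) n
        have : y = p ^ n • (v + w) := by rw [smul_add, ← hv, sub_add_cancel]
        rw [AddMonoidHom.mem_ker, this, map_nsmul, hχ])
    have h1 : ∀ y : G, p • ν (y : G ⧸ P) = χ y := fun y ↦ by
      rw [← hν, ← map_nsmul]; rfl
    refine ⟨ν.comp (QuotientAddGroup.mk' P), fun y ↦ ?_, h1⟩
    calc p ^ (n + 1) • ν (y : G ⧸ P) = p ^ n • (p • ν (y : G ⧸ P)) := by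
          rw [smul_smul, ← pow_succ]
      _ = 0 := by rw [h1, hχ]
  choose! nxt hn1 hn2 using step
  let χ : ℕ → G →+ UnitAddCircle := fun n ↦
    Nat.rec (ZMod.toAddCircle.comp ψ₁) (fun n χ ↦ nxt (n + 1) χ) n
  have hχ0 : ∀ y, χ 0 y = ZMod.toAddCircle (ψ₁ y) := fun _ ↦ rfl
  have hχN : ∀ n y, p ^ (n + 1) • χ n y = 0 := by
    intro n
    induction n with
    | zero =>
      intro y
      rw [hχ0, zero_add, pow_one, ← map_nsmul]
      simp
    | succ n ih => exact hn1 _ _ ih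
  have hχp : ∀ n y, p • χ (n + 1) y = χ n y := fun n ↦ hn2 _ _ (hχN n)
  have hψ : ∀ n, ∃ ψ : G →+ ZMod (p ^ (n + 1)), ∀ a, ZMod.toAddCircle (ψ a) = χ n a :=
    fun n ↦ exists_zmod_hom_toAddCircle_eq _ _ (hχN n)
  choose ψ hψ using hψ
  -- The dummy value at 0 shifts indices so that the n-th term is a representative modulo p^n.
  let c : G → ℕ → ℤ := fun y n ↦ Nat.rec 0 (fun n _ ↦ ((ψ n y).val : ℤ)) n
  have hcψ : ∀ y n, ((c y (n + 1) : ℤ) : ZMod (p ^ (n + 1))) = ψ n y := fun y n ↦ by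
    simp [c]
  have hc : ∀ y n, (p : ℤ) ^ n ∣ c y (n + 1) - c y n := by
    intro y n
    cases n with
    | zero => simp
    | succ n =>
      have key : ((c y (n + 2) : ℤ) : ZMod (p ^ (n + 1))) = (c y (n + 1) : ℤ) := by
        refine ZMod.toAddCircle_injective _ ?_
        rw [hcψ y n, hψ n y, ← hχp n y, ← hψ (n + 1) y, ← hcψ y (n + 1), ZMod.toAddCircle_intCast, ZMod.toAddCircle_intCast,
          ← AddCircle.coe_nsmul]
        congr 1
        have : (p : ℝ) ≠ 0 := Nat.cast_ne_zero.2 hp.out.ne_zero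
        push_cast
        rw [nsmul_eq_mul, pow_succ _ (n + 1)]
        field_simp
      have h2 := (ZMod.intCast_eq_intCast_iff_dvd_sub _ _ _).1 key.symm
      exact_mod_cast h2
  let g : G → ℤ_[p] := fun y ↦
    PadicInt.ofIntSeq _ (PadicInt.isCauSeq_padicNorm_of_pow_dvd_sub (c y) p (hc y))
  have hg : ∀ y n, PadicInt.toZModPow (n + 1) (g y) = ψ n y := fun y n ↦
    (PadicInt.toZModPow_ofIntSeq_of_pow_dvd_sub (c y) p (hc y) (n + 1)).trans (hcψ y n)
  refine ⟨AddMonoidHom.mk' g fun a b ↦ PadicInt.ext_of_toZModPow.1 fun n ↦ ?_, fun y ↦ ?_⟩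
  · cases n with
    | zero => exact Subsingleton.elim (α := ZMod 1) _ _
    | succ n => rw [map_add, hg, hg, hg, map_add]
  · obtain ⟨j, hj⟩ := ZMod.intCast_surjective (ψ₁ y)
    have h1 : ψ 0 y = ((j : ℤ) : ZMod (p ^ (0 + 1))) := by
      refine ZMod.toAddCircle_injective _ ?_
      rw [hψ, hχ0, ← hj, ZMod.toAddCircle_intCast, ZMod.toAddCircle_intCast]
      simp
    have h2 : PadicInt.toZModPow 1 (g y - (j : ℤ_[p])) = 0 := by
      rw [map_sub, map_intCast, sub_eq_zero]
      exact (hg y 0).trans h1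
    rw [← RingHom.mem_ker, PadicInt.ker_toZModPow, pow_one, ← PadicInt.maximalIdeal_eq_span_p,
      ← PadicInt.ker_toZMod, RingHom.mem_ker, map_sub, map_intCast, sub_eq_zero, hj] at h2
    exact h2

/-- Additive endomorphisms of the `p`-adic integers are multiplications. -/
theorem padicInt_addMonoidHom_apply (p : ℕ) [hp : Fact p.Prime] (h : ℤ_[p] →+ ℤ_[p])
    (z : ℤ_[p]) : h z = h 1 * z := by
  refine PadicInt.ext_of_toZModPow.1 fun n ↦ ?_
  obtain ⟨w, hw⟩ := Ideal.mem_span_singleton.1 (PadicInt.appr_spec n z)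
  have hz : z = (z.appr n) • (1 : ℤ_[p]) + (p ^ n) • w := by
    rw [nsmul_eq_mul, nsmul_eq_mul, mul_one, Nat.cast_pow, ← hw]; ring
  have hpn : ((p ^ n : ℕ) : ZMod (p ^ n)) = 0 := ZMod.natCast_self _
  generalize z.appr n = m at hz
  rw [hz, map_add, map_nsmul, map_nsmul]
  simp only [nsmul_eq_mul, map_add, map_mul, map_natCast, map_one, hpn]
  ring

/-! ### Co-finite surjectivity and divisibility -/

theorem finite_quotient_range_of_ker_le {G M : Type*} [AddCommGroup G] [AddCommGroup M] [Finite M]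
    (φ : G →+ G) (ψ : G →+ M) (h : ψ.ker ≤ φ.range) : Finite (G ⧸ φ.range) := by
  have : Finite (G ⧸ ψ.ker) :=
    Finite.of_injective _ (QuotientAddGroup.kerLift_injective ψ)
  refine Finite.of_surjective
    (QuotientAddGroup.map ψ.ker φ.range (AddMonoidHom.id G) h) fun q ↦ ?_
  obtain ⟨z, rfl⟩ := QuotientAddGroup.mk_surjective q
  exact ⟨(z : G ⧸ ψ.ker), rfl⟩

theorem IsCoFinitelySurjective.nsmul_prime_surjective {G : Type u} [AddCommGroup G]
    (hG : IsCotorsion G) (hs : IsCoFinitelySurjective G) (p : ℕ) [hp : Fact p.Prime] (x : G) :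
    ∃ w : G, p • w = x := by
  by_contra! hx
  by_cases hsoc : ∀ z : G, p • z = 0 → ∀ n : ℕ, ∃ w : G, z = p ^ n • w
  · obtain ⟨ψ₁, hψ₁⟩ : ∃ ψ₁ : G →+ ZMod p, ψ₁ x = 1 := by
      have := exists_zmod_hom_apply_eq_one p 0 x (fun w hw ↦ hx w (by simpa using hw.symm))
      rwa [zero_add, pow_one] at this
    obtain ⟨g, hg⟩ := exists_padicInt_hom_lift p hsoc ψ₁
    obtain ⟨f, w, hfx⟩ := hG.exists_padicInt_hom p x
    have hgf1 : PadicInt.toZMod (g (f 1)) = 1 := by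
      have : ψ₁ x = ψ₁ (f 1) := by rw [hfx, map_add, map_nsmul]; simp
      rw [hg, ← this, hψ₁]
    have hmem : ∀ a : ℤ_[p], PadicInt.toZMod a = 0 ↔ (p : ℤ_[p]) ∣ a := fun a ↦ by
      rw [← RingHom.mem_ker, PadicInt.ker_toZMod, PadicInt.maximalIdeal_eq_span_p,
        Ideal.mem_span_singleton]
    have hunit : IsUnit (g (f 1)) := by
      by_contra hnu
      rw [PadicInt.not_isUnit_iff, PadicInt.norm_lt_one_iff_dvd, ← hmem, hgf1] at hnu
      exact one_ne_zero hnu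
    obtain ⟨v, hv⟩ := hunit.exists_right_inv
    have hgf : ∀ b, g (f b) = g (f 1) * b := fun b ↦
      padicInt_addMonoidHom_apply p (g.comp f) b
    -- With v inverse to g (f 1), this is the identity on ker g and multiplication by p on the
    -- summand f(`ℤ_[p]`); thus g ∘ φ = p g.
    let φ : G →+ G := AddMonoidHom.id G -
      f.comp ((AddMonoidHom.mulLeft ((1 - p) * v)).comp g)
    have hφ : ∀ y, φ y = y - f ((1 - p) * v * g y) := fun _ ↦ rfl
    have hfin : Finite (G ⧸ φ.range) := by
      refine finite_quotient_range_of_ker_le φ ψ₁ fun z hz ↦ ?_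
      rw [AddMonoidHom.mem_ker, ← hg, hmem] at hz
      obtain ⟨b, hb⟩ := hz
      refine ⟨z + f ((1 - p) * v * b), ?_⟩
      rw [hφ, map_add, hgf, add_sub_assoc, ← map_sub]
      have : (1 - p) * v * b - (1 - p) * v * (g z + g (f 1) * ((1 - p) * v * b)) =
          (1 - p) * v * b * (1 - (1 - p) * (g (f 1) * v)) - (1 - p) * v * g z := by ring
      rw [this, hv, hb]
      have h0 : (1 - (p : ℤ_[p])) * v * b * (1 - (1 - p) * 1) - (1 - p) * v * (p * b) = 0 := by
        ring
      rw [h0, map_zero, add_zero]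
    obtain ⟨y, hy⟩ := hs φ hfin x
    have h1 : ψ₁ (φ y) = 0 := by
      rw [← hg, hφ, map_sub, hgf, hmem]
      refine ⟨g y, ?_⟩
      linear_combination (-(1 - (p : ℤ_[p])) * g y) * hv
    rw [hy, hψ₁] at h1
    exact one_ne_zero h1
  · push Not at hsoc
    obtain ⟨z, hz, hn⟩ := hsoc
    -- k is the exact p-height of z; then y generates a direct summand of order p^(k+1).
    obtain ⟨k, ⟨y, hy⟩, hk⟩ : ∃ k, (∃ y : G, z = p ^ k • y) ∧ ∀ w : G, z ≠ p ^ (k + 1) • w := by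
      by_contra! hcon
      obtain ⟨n, hn⟩ := hn
      have : ∀ m : ℕ, ∃ w : G, z = p ^ m • w := by
        intro m
        induction m with
        | zero => exact ⟨z, by simp⟩
        | succ m ih => exact hcon m ih
      obtain ⟨w, hw⟩ := this n
      exact hn w hw
    obtain ⟨ψ, hψ⟩ := exists_zmod_hom_apply_eq_one p k y (by rw [← hy]; exact hk)
    have hyN : p ^ (k + 1) • y = 0 := by rw [pow_succ', mul_smul, ← hy, hz]
    let N := p ^ (k + 1)
    have : NeZero N := ⟨pow_ne_zero _ hp.out.ne_zero⟩
    have : Fact (1 < N) := ⟨Nat.one_lt_pow (by omega) hp.out.one_lt⟩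
    let α : ZMod N →+ G := ZMod.lift N ⟨zmultiplesHom _ y, by simpa using hyN⟩
    have hψα : ∀ c, ψ (α c) = c := by
      intro c
      obtain ⟨j, rfl⟩ := ZMod.intCast_surjective c
      have : α (j : ZMod N) = j • y := by simp [α]
      rw [this, map_zsmul, hψ]
      simp
    let φ : G →+ G := AddMonoidHom.id G - α.comp ψ
    have hφ : ∀ y, φ y = y - α (ψ y) := fun _ ↦ rfl
    have hfin : Finite (G ⧸ φ.range) :=
      have : Finite (ZMod (p ^ (k + 1))) := inferInstanceAs (Finite (ZMod N))
      finite_quotient_range_of_ker_le φ ψ fun a ha ↦ ⟨a, by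
        rw [AddMonoidHom.mem_ker] at ha
        rw [hφ, ha, map_zero, sub_zero]⟩
    obtain ⟨a, ha⟩ := hs φ hfin y
    have h1 : ψ (φ a) = 0 := by rw [hφ, map_sub, hψα, sub_self]
    rw [ha, hψ] at h1
    exact one_ne_zero (α := ZMod N) h1

theorem isDivisibleGroup_of_prime {G : Type u} [AddCommGroup G]
    (h : ∀ p : ℕ, p.Prime → ∀ x : G, ∃ w : G, p • w = x) : IsDivisibleGroup G := by
  have hn : ∀ n : ℕ, n ≠ 0 → ∀ x : G, ∃ w : G, n • w = x := by
    intro n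
    induction n using Nat.recOnMul with
    | zero => intro h0; exact absurd rfl h0
    | one => intro _ x; exact ⟨x, one_smul _ _⟩
    | prime p hp => intro _; exact h p hp
    | mul a b iha ihb =>
      intro hab x
      obtain ⟨u, rfl⟩ := iha (left_ne_zero_of_mul hab) x
      obtain ⟨v, rfl⟩ := ihb (right_ne_zero_of_mul hab) u
      exact ⟨v, mul_smul _ _ _⟩
  refine ⟨divisibleByOfSMulRightSurj G ℤ fun {n} hn0 x ↦ ?_⟩
  obtain ⟨w, hw⟩ := hn n.natAbs (Int.natAbs_ne_zero.2 hn0) x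
  rcases Int.natAbs_eq n with h | h
  · exact ⟨w, by rw [← hw]; simp only; rw [h, Int.natAbs_natCast, natCast_zsmul]⟩
  · refine ⟨-w, ?_⟩
    rw [← hw]; simp only; rw [h, Int.natAbs_neg, Int.natAbs_natCast, neg_smul_neg, natCast_zsmul]

theorem IsDivisibleGroup.exists_nsmul_eq {G : Type u} [AddCommGroup G] (h : IsDivisibleGroup G)
    {n : ℕ} (hn : n ≠ 0) (x : G) : ∃ w : G, n • w = x := by
  obtain ⟨_⟩ := h
  refine ⟨DivisibleBy.div x (n : ℤ), ?_⟩
  rw [← natCast_zsmul, DivisibleBy.div_cancel x (Nat.cast_ne_zero.2 hn)]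

theorem IsDivisibleGroup.isCoFinitelySurjective {G : Type u} [AddCommGroup G]
    (h : IsDivisibleGroup G) : IsCoFinitelySurjective G := by
  intro φ hfin x
  have hc : Nat.card (G ⧸ φ.range) ≠ 0 := Nat.card_pos.ne'
  obtain ⟨w, rfl⟩ := h.exists_nsmul_eq hc x
  have h0 : Nat.card (G ⧸ φ.range) • (w : G ⧸ φ.range) = 0 := card_nsmul_eq_zero'
  exact (QuotientAddGroup.eq_zero_iff _).1 h0

theorem isCoFinitelySurjective_iff_isDivisibleGroup {G : Type u} [AddCommGroup G]
    (hG : IsCotorsion G) : IsCoFinitelySurjective G ↔ IsDivisibleGroup G :=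
  ⟨fun hs ↦ isDivisibleGroup_of_prime fun p hp x ↦
    have : Fact p.Prime := ⟨hp⟩
    IsCoFinitelySurjective.nsmul_prime_surjective hG hs p x,
    fun h ↦ h.isCoFinitelySurjective⟩

/-! ### Co-finitely Hopfian groups and rank -/

theorem IsCoFinitelyHopfian.injective_of_surjective {G : Type u} [AddCommGroup G]
    (h : IsCoFinitelyHopfian G) {φ : G →+ G} (hφ : Function.Surjective φ) :
    Function.Injective φ := by
  refine (h φ ?_).1
  have : Subsingleton (G ⧸ φ.range) :=
    ⟨fun a b ↦ by
      obtain ⟨a, rfl⟩ := QuotientAddGroup.mk_surjective a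
      obtain ⟨b, rfl⟩ := QuotientAddGroup.mk_surjective b
      exact QuotientAddGroup.eq.2 (hφ _)⟩
  infer_instance

theorem IsCoFinitelyHopfian.isAddTorsionFree {G : Type u} [AddCommGroup G]
    (h : IsCoFinitelyHopfian G) (hd : IsDivisibleGroup G) : IsAddTorsionFree G :=
  ⟨fun n hn ↦ h.injective_of_surjective (φ := nsmulAddMonoidHom n) (hd.exists_nsmul_eq hn)⟩

/-- A module of infinite rank over a domain, on which nonzero scalars act bijectively, has a
surjective endomorphism that is not injective. -/
theorem exists_linearMap_surjective_not_injective {R : Type} {M : Type u} [CommRing R]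
    [IsDomain R] [AddCommGroup M] [Module R M] [IsLocalizedModule (nonZeroDivisors R) (LinearMap.id : M →ₗ[R] M)]
    (hr : Cardinal.aleph0 ≤ Module.rank R M) :
    ∃ φ : M →ₗ[R] M, Function.Surjective φ ∧ ¬ Function.Injective φ := by
  let S := nonZeroDivisors R
  let V := LocalizedModule S M
  let K := FractionRing R
  let e : V ≃ₗ[R] M := IsLocalizedModule.iso S LinearMap.id
  have hV : Cardinal.aleph0 ≤ Module.rank K V := by
    rw [IsLocalization.rank_eq (R := R) K S le_rfl, e.rank_eq]
    exact hr
  -- Infinite dimension absorbs one more coordinate; forgetting that coordinate is onto but not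
  -- injective.
  obtain ⟨d⟩ : Nonempty (V ≃ₗ[K] V × K) := by
    refine nonempty_linearEquiv_of_lift_rank_eq ?_
    rw [rank_prod, Module.rank_self]
    simp [hV]
  refine ⟨e.toLinearMap ∘ₗ ((LinearMap.fst K V K ∘ₗ d.toLinearMap).restrictScalars R) ∘ₗ
    e.symm.toLinearMap, ?_, fun hinj ↦ ?_⟩
  · exact e.surjective.comp ((Prod.fst_surjective.comp d.surjective).comp e.symm.surjective)
  · have h01 : e (d.symm (0, 1)) = e (d.symm (0, 0)) := hinj (by simp)
    have := congrArg Prod.snd (d.symm.injective (e.injective h01))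
    exact one_ne_zero this

/-- A torsion-free divisible group of infinite rank is isomorphic to a proper quotient. -/
theorem exists_surjective_not_injective_of_aleph0_le_rank {G : Type u} [AddCommGroup G]
    [IsAddTorsionFree G] (hd : IsDivisibleGroup G) (hr : Cardinal.aleph0 ≤ Module.rank ℤ G) :
    ∃ φ : G →+ G, Function.Surjective φ ∧ ¬ Function.Injective φ := by
  obtain ⟨_⟩ := hd
  have : IsLocalizedModule (nonZeroDivisors ℤ) (LinearMap.id : G →ₗ[ℤ] G) :=
    { map_units := fun n ↦ by
        have hn : (n : ℤ) ≠ 0 := nonZeroDivisors.coe_ne_zero n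
        rw [Module.End.isUnit_iff]
        exact ⟨zsmul_right_injective hn, DivisibleBy.surjective_smul G ℤ hn⟩
      surj := fun y ↦ ⟨(y, 1), one_smul _ _⟩
      exists_of_eq := fun h ↦ ⟨1, congrArg _ h⟩ }
  obtain ⟨φ, hφ⟩ := exists_linearMap_surjective_not_injective hr
  exact ⟨φ.toAddMonoidHom, hφ⟩

/-- Surjective endomorphisms of torsion-free groups of finite rank are injective. -/
theorem injective_of_surjective_of_rank_lt_aleph0 {G : Type u} [AddCommGroup G]
    [IsAddTorsionFree G] (hr : Module.rank ℤ G < Cardinal.aleph0) (φ : G →+ G)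
    (hφ : Function.Surjective φ) : Function.Injective φ := by
  have h := LinearMap.rank_range_add_rank_ker φ.toIntLinearMap
  rw [LinearMap.range_eq_top.2 hφ, rank_top] at h
  -- Cancelling the rank is legitimate because it is finite; a rank-zero subgroup of a torsion-free
  -- group is trivial.
  have h0 : Module.rank ℤ (LinearMap.ker φ.toIntLinearMap) = 0 :=
    Cardinal.eq_of_add_eq_add_left (h.trans (add_zero _).symm) hr
  have hb : LinearMap.ker φ.toIntLinearMap = ⊥ := Submodule.rank_eq_zero.1 h0
  exact LinearMap.ker_eq_bot.1 hb

theorem proposition4p1 (G : Type u) [AddCommGroup G] (hG : IsCotorsion G) :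
    (IsCoFinitelySurjective G ↔ IsDivisibleGroup G) ∧
    (IsCoFinitelyHopfian G ↔
      IsAddTorsionFree G ∧ IsDivisibleGroup G ∧ Module.rank ℤ G < Cardinal.aleph0) := by
  refine ⟨isCoFinitelySurjective_iff_isDivisibleGroup hG, fun h ↦ ?_, ?_⟩
  · have hd : IsDivisibleGroup G := (isCoFinitelySurjective_iff_isDivisibleGroup hG).1
      fun φ hφ ↦ (h φ hφ).2
    have := h.isAddTorsionFree hd
    refine ⟨inferInstance, hd, not_le.1 fun hr ↦ ?_⟩
    obtain ⟨φ, hs, hi⟩ := exists_surjective_not_injective_of_aleph0_le_rank hd hr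
    exact hi (h.injective_of_surjective hs)
  · rintro ⟨_, hd, hr⟩ φ hφ
    have hs := hd.isCoFinitelySurjective φ hφ
    exact ⟨injective_of_surjective_of_rank_lt_aleph0 hr φ hs, hs⟩
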